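/- Let $\mathbb{D}=\{z\in\mathbb{C}:|z|<1\}$ and let $\mathcal{A}$ be the class of analytic functions $f$ on $\mathbb{D}$ with $f(0)=0$ and $f'(0)=1$, written $f(z)=z+\sum_{n\ge 2}a_nz^n$. Let $\mathcal{S}^*_e$ be the class of all $f\in\mathcal{A}$ without zeros in $\mathbb{D}\setminus\{0\}$ such that $zf'(z)/f(z)$ (with the value $1$ at $z=0$) is subordinate to $e^z$, that is, there is an analytic function $w$ on $\mathbb{D}$ with $w(0)=0$ and $|w(z)|\le|z|$ such that $zf'(z)/f(z)=e^{w(z)}$ for all $z\in\mathbb{D}$. With $a_1=1$, let $$H_{3,1}(f)=\begin{vmatrix}a_1&a_2&a_3\\a_2&a_3&a_4\\a_3&a_4&a_5\end{vmatrix}.$$ Then for every $f\in\mathcal{S}^*_e$, $$H_{3,1}(f)=2a_2a_3a_4-a_3^3-a_4^2-a_2^2a_5+a_3a_5\quad\text{and}\quad |H_{3,1}(f)|\le\frac19.$$ The bound is sharp: the function $f_1(z)=z\exp\left(\int_0^z\frac{e^{t^3}-1}{t}\,dt\right)$ belongs to $\mathcal{S}^*_e$ and $|H_{3,1}(f_1)|=\frac19$.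 -/

import Mathlib

/-!
Normalized analytic functions on the unit disk, subordination, Ma-Minda starlike classes and
Hankel determinants. A function on the open unit disk is represented by a function `ℂ → ℂ`, of
which only the values on the disk matter.
-/

open Complex Metric

/-- The class `𝒜` of analytic functions `f` on the open unit disk, normalized by `f 0 = 0` and
`f' 0 = 1`, that is, `f z = z + ∑_{n ≥ 2} a_n z ^ n`. -/
def classA : Set (ℂ → ℂ) :=
  {f | DifferentiableOn ℂ f (ball (0 : ℂ) 1) ∧ f 0 = 0 ∧ deriv f 0 = 1}

/-- A Schwarz function: `w` is analytic on the open unit disk, `w 0 = 0` and `‖w z‖ ≤ ‖z‖`. -/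
def IsSchwarzFunction (w : ℂ → ℂ) : Prop :=
  DifferentiableOn ℂ w (ball (0 : ℂ) 1) ∧ w 0 = 0 ∧ ∀ z ∈ ball (0 : ℂ) 1, ‖w z‖ ≤ ‖z‖

/-- Subordination `h₁ ≺ h₂` of analytic functions on the open unit disk. -/
def IsSubordinate (h₁ h₂ : ℂ → ℂ) : Prop :=
  DifferentiableOn ℂ h₁ (ball (0 : ℂ) 1) ∧ DifferentiableOn ℂ h₂ (ball (0 : ℂ) 1) ∧
    ∃ w : ℂ → ℂ, IsSchwarzFunction w ∧ ∀ z ∈ ball (0 : ℂ) 1, h₁ z = h₂ (w z)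

/-- The function `z ↦ z f'(z) / f(z)`, with its removable singularity at `0` filled in: for
`f` in `classA` the limit at `0` is `1`. -/
noncomputable def starlikeQuotient (f : ℂ → ℂ) : ℂ → ℂ :=
  Function.update (fun z => z * deriv f z / f z) 0 1

/-- The Ma-Minda class `𝒮*(φ)`: all `f` in `classA` with `z f'(z) / f(z) ≺ φ(z)`. That `f` has no
zero in the punctured disk says that the quotient is defined there. -/
def starlikeClass (φ : ℂ → ℂ) : Set (ℂ → ℂ) :=
  {f | f ∈ classA ∧ (∀ z ∈ ball (0 : ℂ) 1, z ≠ 0 → f z ≠ 0) ∧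
    IsSubordinate (starlikeQuotient f) φ}

/-- The class `𝒮*_e`: all `f` in `classA` with `z f'(z) / f(z) ≺ e ^ z`. -/
noncomputable def starlikeExp : Set (ℂ → ℂ) := starlikeClass Complex.exp

/-- The `n`-th Taylor coefficient `a_n` of `f` at `0`. -/
noncomputable def taylorCoeff (f : ℂ → ℂ) (n : ℕ) : ℂ :=
  iteratedDeriv n f 0 / (n.factorial : ℂ)

/-- The Hankel determinant `H_{q,n}(f)`, the determinant of the `q × q` matrix with entries
`a_{n + i + j}` for `0 ≤ i, j < q`. -/
noncomputable def hankelDet (q n : ℕ) (f : ℂ → ℂ) : ℂ :=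
  (Matrix.of fun i j : Fin q => taylorCoeff f (n + (i : ℕ) + (j : ℕ))).det

/-- The integral `∫_0^z g(t) dt` along the line segment from `0` to `z`. -/
noncomputable def segmentIntegral (g : ℂ → ℂ) (z : ℂ) : ℂ :=
  ∫ s in (0 : ℝ)..1, g ((s : ℂ) * z) * z

/-- The function `f₁(z) = z exp (∫_0^z (e ^ (t ^ 3) - 1) / t dt)`. At `t = 0` Lean's value `0` of
the integrand is also its limit, so that the integrand is the entire function meant. -/
noncomputable def extremalFun (z : ℂ) : ℂ :=
  z * Complex.exp (segmentIntegral (fun t => (Complex.exp (t ^ 3) - 1) / t) z)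

/-!
If `f ∈ 𝒮*_e` and `z f'(z) = f(z) e ^ w(z)` with the Schwarz function `w(z) = ∑ c_k z ^ k`, then
comparing coefficients makes `H_{3,1}(f)` a polynomial in `c₁, …, c₄`, namely `-c₃ ^ 2 / 9` plus
terms that are linear in `c₄` or contain a factor `c₁`
(`hankelDet_eq_of_mul_deriv_eq`). The only information needed about the `c_k` is Bessel's inequality
`|c₁| ^ 2 + |c₂| ^ 2 + |c₃| ^ 2 + |c₄| ^ 2 ≤ 1`, which holds because `w` is bounded by `1`
(`sum_sq_norm_taylorCoeff_le`). The dominant part of the determinant is then harmless, since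
`|c₃| ^ 2 / 9 + |c₂ c₄| / 8 ≤ |c₃| ^ 2 / 9 + (|c₂| ^ 2 + |c₄| ^ 2) / 16`, and the remaining terms
are absorbed by the slack of this estimate and by `|c₁| ^ 2 / 9` (`hankel_majorant_le`).

Equality forces all the mass onto `c₃`, that is, up to a rotation, `w(z) = z ^ 3`, and the function with this `w` is
`extremalFun`, with determinant `-1 / 9` (`hankelDet_extremalFun`).
-/

/-! ### Taylor coefficients -/

theorem taylorCoeff_congr {f g : ℂ → ℂ} (h : f =ᶠ[nhds 0] g) (n : ℕ) :
    taylorCoeff f n = taylorCoeff g n := by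
  rw [taylorCoeff, taylorCoeff, (h.iteratedDeriv n).eq_of_nhds]

theorem taylorCoeff_zero (f : ℂ → ℂ) : taylorCoeff f 0 = f 0 := by
  simp [taylorCoeff]

theorem taylorCoeff_one (f : ℂ → ℂ) : taylorCoeff f 1 = deriv f 0 := by
  simp [taylorCoeff]

theorem taylorCoeff_pow (m n : ℕ) :
    taylorCoeff (fun z => z ^ m) n = if n = m then 1 else 0 := by
  rw [taylorCoeff, iteratedDeriv_fun_pow_zero]
  split_ifs with h
  · rw [h, div_self (mod_cast m.factorial_ne_zero)]
  · simp

theorem taylorCoeff_deriv (f : ℂ → ℂ) (n : ℕ) :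
    taylorCoeff (deriv f) n = (n + 1) * taylorCoeff f (n + 1) := by
  have h₁ : (n.factorial : ℂ) ≠ 0 := mod_cast n.factorial_ne_zero
  have h₂ : (n + 1 : ℂ) ≠ 0 := mod_cast n.succ_ne_zero
  rw [taylorCoeff, taylorCoeff, ← iteratedDeriv_succ', Nat.factorial_succ]
  push_cast
  field_simp

theorem taylorCoeff_mul {f g : ℂ → ℂ} (hf : AnalyticAt ℂ f 0) (hg : AnalyticAt ℂ g 0) (n : ℕ) :
    taylorCoeff (f * g) n =
      ∑ k ∈ Finset.range (n + 1), taylorCoeff f k * taylorCoeff g (n - k) := by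
  simp only [taylorCoeff]
  rw [iteratedDeriv_mul hf.contDiffAt hg.contDiffAt, Finset.sum_div]
  refine Finset.sum_congr rfl fun i hi => ?_
  rw [Nat.cast_choose _ (by grind)]
  have h₁ : (n.factorial : ℂ) ≠ 0 := mod_cast n.factorial_ne_zero
  field_simp

theorem taylorCoeff_id_mul {f : ℂ → ℂ} (hf : AnalyticAt ℂ f 0) (n : ℕ) :
    taylorCoeff ((fun z => z) * f) (n + 1) = taylorCoeff f n := by
  have hid (k : ℕ) : taylorCoeff (fun z => z) k = if k = 1 then 1 else 0 := by
    simpa using taylorCoeff_pow 1 k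
  rw [taylorCoeff_mul (f := fun z => z) analyticAt_id hf]
  simp [hid]

/-- The coefficient recursion expressing `(exp ∘ w)' = (exp ∘ w) * w'`. -/
theorem taylorCoeff_exp_comp_succ {w : ℂ → ℂ} (hw : AnalyticAt ℂ w 0) (n : ℕ) :
    (n + 1) * taylorCoeff (fun z => exp (w z)) (n + 1) =
      ∑ k ∈ Finset.range (n + 1),
        taylorCoeff (fun z => exp (w z)) k * (((n - k : ℕ) + 1) * taylorCoeff w (n - k + 1)) := by
  have h : deriv (fun z => exp (w z)) =ᶠ[nhds 0] (fun z => exp (w z)) * deriv w := by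
    filter_upwards [hw.eventually_analyticAt] with z hz
    exact hz.differentiableAt.hasDerivAt.cexp.deriv
  rw [← taylorCoeff_deriv, taylorCoeff_congr h, taylorCoeff_mul hw.cexp' hw.deriv]
  simp only [taylorCoeff_deriv]

/-- **Bessel's inequality** for the Taylor coefficients of a bounded analytic function. -/
theorem sum_sq_norm_taylorCoeff_le {f : ℂ → ℂ} (hf : DifferentiableOn ℂ f (ball (0 : ℂ) 1))
    {M : ℝ} (hM : ∀ z ∈ ball (0 : ℂ) 1, ‖f z‖ ≤ M) (s : Finset ℕ) :
    ∑ n ∈ s, ‖taylorCoeff f n‖ ^ 2 ≤ M ^ 2 := by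
  -- On the circle of radius `r`, the Fourier coefficients are `r ^ n * a_n`; then let `r → 1`.
  have key (r : ℝ) (hr₀ : 0 < r) (hr₁ : r < 1) :
      ∑ n ∈ s, ‖(r : ℂ) ^ n * taylorCoeff f n‖ ^ 2 ≤ M ^ 2 := by
    have hball (θ : ℝ) : circleMap 0 r θ ∈ ball (0 : ℂ) 1 := by
      simpa [abs_of_pos hr₀] using hr₁
    have hcont : Continuous fun θ : ℝ => f (circleMap 0 r θ) :=
      hf.continuousOn.comp_continuous (continuous_circleMap 0 r) hball
    have hL2 : MeasureTheory.MemLp (fun θ : ℝ => f (circleMap 0 r θ)) 2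
        (MeasureTheory.volume.restrict (Set.Ioc 0 (2 * Real.pi))) :=
      MeasureTheory.MemLp.of_bound hcont.aestronglyMeasurable M
        (Filter.Eventually.of_forall fun θ => hM _ (hball θ))
    have hcoeff (n : ℕ) :
        fourierCoeffOn Real.two_pi_pos (fun θ : ℝ => f (circleMap 0 r θ)) n =
          (r : ℂ) ^ n * taylorCoeff f n := by
      have hc := (hf.mono (closedBall_subset_ball hr₁)).circleIntegral_one_div_sub_center_pow_smul
        hr₀ n
      have hr' : (r : ℂ) ≠ 0 := mod_cast hr₀.ne'
      have hpi : (Real.pi : ℂ) ≠ 0 := mod_cast Real.pi_ne_zero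
      have hint : ∮ z in C(0, r), (1 / (z - 0) ^ (n + 1)) • f z =
          ∫ θ in (0 : ℝ)..2 * Real.pi, (I / (r : ℂ) ^ n) *
            (fourier (-(n : ℤ)) (θ : AddCircle (2 * Real.pi - 0)) • f (circleMap 0 r θ)) := by
        rw [circleIntegral]
        refine intervalIntegral.integral_congr fun θ _ => ?_
        have he : exp (θ * I) ≠ 0 := exp_ne_zero _
        have hexp : exp (2 * Real.pi * I * ((-(n : ℤ) : ℤ) : ℂ) * θ / ((2 * Real.pi - 0 : ℝ) : ℂ))
            = (exp (θ * I) ^ n)⁻¹ := by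
          rw [← exp_nat_mul, ← exp_neg]
          congr 1
          push_cast
          field_simp
          ring
        simp only [fourier_coe_apply, hexp]
        simp only [deriv_circleMap, circleMap, smul_eq_mul, sub_zero, zero_add, mul_pow]
        field_simp
        ring
      rw [fourierCoeffOn_eq_integral]
      rw [hint, intervalIntegral.integral_const_mul] at hc
      rw [taylorCoeff, Complex.real_smul]
      have hn : (n.factorial : ℂ) ≠ 0 := mod_cast n.factorial_ne_zero
      generalize (∫ θ in (0 : ℝ)..2 * Real.pi, _ : ℂ) = J at hc ⊢
      rw [smul_eq_mul] at hc
      push_cast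
      field_simp at hc ⊢
      linear_combination hc
    have hsum := hasSum_sq_fourierCoeffOn Real.two_pi_pos hL2
    calc ∑ n ∈ s, ‖(r : ℂ) ^ n * taylorCoeff f n‖ ^ 2
        = ∑ m ∈ s.map Nat.castEmbedding,
            ‖fourierCoeffOn Real.two_pi_pos (fun θ : ℝ => f (circleMap 0 r θ)) m‖ ^ 2 := by
          rw [Finset.sum_map]
          exact Finset.sum_congr rfl fun n _ => by simp [hcoeff]
      _ ≤ (2 * Real.pi - 0)⁻¹ • ∫ θ in (0 : ℝ)..2 * Real.pi, ‖f (circleMap 0 r θ)‖ ^ 2 :=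
          sum_le_hasSum _ (fun _ _ => by positivity) hsum
      _ ≤ (2 * Real.pi - 0)⁻¹ • ∫ _θ in (0 : ℝ)..2 * Real.pi, M ^ 2 := by
          have h0 : (0 : ℝ) ≤ 2 * Real.pi := Real.two_pi_pos.le
          rw [smul_eq_mul, smul_eq_mul]
          refine mul_le_mul_of_nonneg_left ?_ (by simpa using Real.pi_pos.le)
          refine intervalIntegral.integral_mono_on h0 ?_ ?_ fun θ _ => ?_
          · exact (hcont.norm.pow 2).intervalIntegrable _ _
          · exact continuous_const.intervalIntegrable _ _
          · exact pow_le_pow_left₀ (norm_nonneg _) (hM _ (hball θ)) 2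
      _ = M ^ 2 := by
          have := Real.pi_pos
          rw [intervalIntegral.integral_const, smul_eq_mul, smul_eq_mul]
          field_simp
  have hlim : Filter.Tendsto (fun r : ℝ => ∑ n ∈ s, ‖(r : ℂ) ^ n * taylorCoeff f n‖ ^ 2)
      (nhdsWithin 1 (Set.Iio 1)) (nhds (∑ n ∈ s, ‖taylorCoeff f n‖ ^ 2)) := by
    have hc : Continuous fun r : ℝ => ∑ n ∈ s, ‖(r : ℂ) ^ n * taylorCoeff f n‖ ^ 2 := by fun_prop
    simpa using (hc.tendsto 1).mono_left nhdsWithin_le_nhds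
  refine le_of_tendsto hlim ?_
  filter_upwards [Ioo_mem_nhdsLT (zero_lt_one (α := ℝ))] with r hr
  exact key r hr.1 hr.2

/-! ### The Hankel determinant in terms of the Schwarz function -/

theorem hankelDet_three_one {f : ℂ → ℂ} (h₁ : taylorCoeff f 1 = 1) :
    hankelDet 3 1 f =
      2 * taylorCoeff f 2 * taylorCoeff f 3 * taylorCoeff f 4 - taylorCoeff f 3 ^ 3
        - taylorCoeff f 4 ^ 2 - taylorCoeff f 2 ^ 2 * taylorCoeff f 5
        + taylorCoeff f 3 * taylorCoeff f 5 := by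
  rw [hankelDet, Matrix.det_fin_three]
  simp [h₁]
  ring

/-- If `f ∈ 𝒜` satisfies `z f'(z) = f(z) e ^ w(z)`, then `H_{3,1}(f)` is a polynomial in the
coefficients of `w`. -/
theorem hankelDet_eq_of_mul_deriv_eq {f w : ℂ → ℂ} (hf : AnalyticAt ℂ f 0) (hf₀ : f 0 = 0)
    (hf₁ : deriv f 0 = 1) (hw : AnalyticAt ℂ w 0) (hw₀ : w 0 = 0)
    (h : (fun z => z) * deriv f =ᶠ[nhds 0] f * fun z => exp (w z))
    {c₁ c₂ c₃ c₄ : ℂ} (hc₁ : taylorCoeff w 1 = c₁) (hc₂ : taylorCoeff w 2 = c₂)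
    (hc₃ : taylorCoeff w 3 = c₃) (hc₄ : taylorCoeff w 4 = c₄) :
    hankelDet 3 1 f =
      (c₂ / 8 - c₁ ^ 2 / 16) * c₄ - c₃ ^ 2 / 9 + 5 / 72 * (c₁ * c₂ * c₃)
        - 5 / 72 * (c₁ ^ 2 * c₂ ^ 2) + 17 / 432 * (c₁ ^ 3 * c₃) + 13 / 864 * (c₁ ^ 4 * c₂)
        - 13 / 5184 * c₁ ^ 6 := by
  have ha₀ : taylorCoeff f 0 = 0 := by rw [taylorCoeff_zero, hf₀]
  have ha₁ : taylorCoeff f 1 = 1 := by rw [taylorCoeff_one, hf₁]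
  set E : ℂ → ℂ := fun z => exp (w z) with hE
  have hrec (n : ℕ) : (n + 1) * taylorCoeff f (n + 1) =
      ∑ k ∈ Finset.range (n + 2), taylorCoeff f k * taylorCoeff E (n + 1 - k) := by
    rw [← taylorCoeff_mul hf hw.cexp', ← taylorCoeff_congr h, taylorCoeff_id_mul hf.deriv,
      taylorCoeff_deriv]
  have hB₀ : taylorCoeff E 0 = 1 := by simp [taylorCoeff_zero, hE, hw₀]
  have hB₁ : taylorCoeff E 1 = c₁ := by
    simpa [Finset.sum_range_succ, ← hE, hB₀, hc₁] using taylorCoeff_exp_comp_succ hw 0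
  have hB₂ : taylorCoeff E 2 = c₂ + c₁ ^ 2 / 2 := by
    have := taylorCoeff_exp_comp_succ hw 1
    simp only [Finset.sum_range_succ, ← hE, Finset.range_zero, Finset.sum_empty] at this
    norm_num [hB₀, hB₁, hc₁, hc₂] at this
    linear_combination this / 2
  have hB₃ : taylorCoeff E 3 = c₃ + c₁ * c₂ + c₁ ^ 3 / 6 := by
    have := taylorCoeff_exp_comp_succ hw 2
    simp only [Finset.sum_range_succ, ← hE, Finset.range_zero, Finset.sum_empty] at this
    norm_num [hB₀, hB₁, hB₂, hc₁, hc₂, hc₃] at this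
    linear_combination this / 3
  have hB₄ : taylorCoeff E 4 =
      c₄ + c₁ * c₃ + c₂ ^ 2 / 2 + c₁ ^ 2 * c₂ / 2 + c₁ ^ 4 / 24 := by
    have := taylorCoeff_exp_comp_succ hw 3
    simp only [Finset.sum_range_succ, ← hE, Finset.range_zero, Finset.sum_empty] at this
    norm_num [hB₀, hB₁, hB₂, hB₃, hc₁, hc₂, hc₃, hc₄] at this
    linear_combination this / 4
  have ha₂ : taylorCoeff f 2 = c₁ := by
    have := hrec 1
    simp only [Finset.sum_range_succ, Finset.range_zero, Finset.sum_empty] at this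
    norm_num [hB₀, hB₁, hB₂, ha₀, ha₁] at this
    linear_combination this
  have ha₃ : taylorCoeff f 3 = c₂ / 2 + 3 / 4 * c₁ ^ 2 := by
    have := hrec 2
    simp only [Finset.sum_range_succ, Finset.range_zero, Finset.sum_empty] at this
    norm_num [hB₀, hB₁, hB₂, hB₃, ha₀, ha₁, ha₂] at this
    linear_combination this / 2
  have ha₄ : taylorCoeff f 4 = c₃ / 3 + 5 / 6 * (c₁ * c₂) + 17 / 36 * c₁ ^ 3 := by
    have := hrec 3
    simp only [Finset.sum_range_succ, Finset.range_zero, Finset.sum_empty] at this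
    norm_num [hB₀, hB₁, hB₂, hB₃, hB₄, ha₀, ha₁, ha₂, ha₃] at this
    linear_combination this / 3
  have ha₅ : taylorCoeff f 5 =
      c₄ / 4 + 7 / 12 * (c₁ * c₃) + c₂ ^ 2 / 4 + 5 / 6 * (c₁ ^ 2 * c₂) + 19 / 72 * c₁ ^ 4 := by
    have := hrec 4
    simp only [Finset.sum_range_succ, Finset.range_zero, Finset.sum_empty] at this
    norm_num [hB₀, hB₁, hB₂, hB₃, hB₄, ha₀, ha₁, ha₂, ha₃, ha₄] at this
    linear_combination this / 4
  rw [hankelDet_three_one ha₁, ha₂, ha₃, ha₄, ha₅]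
  ring

/-- In the class `𝒮*_e` the quotient condition becomes `z f'(z) = f(z) e ^ w(z)` near `0`, without
division. -/
theorem exists_schwarz_mul_deriv_eq {f : ℂ → ℂ} (hf : f ∈ starlikeExp) :
    ∃ w, IsSchwarzFunction w ∧
      (fun z => z) * deriv f =ᶠ[nhds 0] f * fun z => exp (w z) := by
  obtain ⟨⟨-, hf₀, -⟩, hne, -, -, w, hw, h⟩ := hf
  refine ⟨w, hw, ?_⟩
  filter_upwards [ball_mem_nhds (0 : ℂ) one_pos] with z hz
  rcases eq_or_ne z 0 with rfl | hz₀
  · simp [hf₀]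
  · have hq := h z hz
    rw [starlikeQuotient, Function.update_of_ne hz₀, div_eq_iff (hne z hz hz₀)] at hq
    simpa [mul_comm] using hq

/-! ### The estimate -/

/-- The triangle-inequality majorant of the Hankel determinant is at most `1 / 9` on the unit ball
of `ℝ⁴`; equality holds where only `z`, the norm of the third coefficient, is nonzero. -/
theorem hankel_majorant_le {x y z t : ℝ} (hx : 0 ≤ x) (hy : 0 ≤ y) (hz : 0 ≤ z) (ht : 0 ≤ t)
    (h : x ^ 2 + y ^ 2 + z ^ 2 + t ^ 2 ≤ 1) :
    (y / 8 + x ^ 2 / 16) * t + z ^ 2 / 9 + 5 / 72 * (x * y * z) + 5 / 72 * (x ^ 2 * y ^ 2)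
      + 17 / 432 * (x ^ 3 * z) + 13 / 864 * (x ^ 4 * y) + 13 / 5184 * x ^ 6 ≤ 1 / 9 := by
  have hx₁ : x ≤ 1 := by nlinarith [sq_nonneg y, sq_nonneg z, sq_nonneg t]
  have hz₁ : z ≤ 1 := by nlinarith [sq_nonneg x, sq_nonneg y, sq_nonneg t]
  have hxy : 0 ≤ x * y := mul_nonneg hx hy
  -- `2 x y ≤ x ^ 2 + y ^ 2 ≤ 1 - z ^ 2 ≤ 2 (1 - z)`, hence `z + x y ≤ 1`.
  have hzxy : z + x * y ≤ 1 := by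
    nlinarith [sq_nonneg (x - y), sq_nonneg t, sq_nonneg (1 - z)]
  have h₁ : x * y * z + x ^ 2 * y ^ 2 ≤ x * y := by
    nlinarith [mul_le_mul_of_nonneg_left hzxy hxy]
  have h₂ : x ^ 2 * t ≤ x * t := by
    nlinarith [mul_nonneg (mul_nonneg hx ht) (sub_nonneg.2 hx₁)]
  have hx₂ : x ^ 2 ≤ 1 := pow_le_one₀ hx hx₁
  have hx₃ : x ^ 3 ≤ 1 := pow_le_one₀ hx hx₁
  have h₃ : x ^ 3 * z ≤ x * z := by
    nlinarith [mul_nonneg (mul_nonneg hx hz) (sub_nonneg.2 hx₂)]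
  have h₄ : x ^ 4 * y ≤ x * y := by nlinarith [mul_nonneg hxy (sub_nonneg.2 hx₃)]
  have h₅ : x ^ 6 ≤ x ^ 2 := pow_le_pow_of_le_one hx hx₁ (by norm_num)
  nlinarith [sq_nonneg (y - t), sq_nonneg (x - t), sq_nonneg (x - y), sq_nonneg (x - z)]

theorem norm_hankelDet_three_one_le {f : ℂ → ℂ} (hf : f ∈ starlikeExp) :
    ‖hankelDet 3 1 f‖ ≤ 1 / 9 := by
  obtain ⟨w, ⟨hwd, hw₀, hwn⟩, h⟩ := exists_schwarz_mul_deriv_eq hf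
  have hnhds : ball (0 : ℂ) 1 ∈ nhds 0 := ball_mem_nhds 0 one_pos
  have hbessel := sum_sq_norm_taylorCoeff_le hwd (M := 1)
    (fun z hz => (hwn z hz).trans (mem_ball_zero_iff.1 hz).le) (Finset.Icc 1 4)
  rw [show Finset.Icc 1 4 = {1, 2, 3, 4} from rfl] at hbessel
  obtain ⟨⟨hfd, hf₀, hf₁⟩, -⟩ := hf
  rw [hankelDet_eq_of_mul_deriv_eq (hfd.analyticAt hnhds) hf₀ hf₁ (hwd.analyticAt hnhds) hw₀ h
    rfl rfl rfl rfl]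
  have hsq : ‖taylorCoeff w 1‖ ^ 2 + ‖taylorCoeff w 2‖ ^ 2 + ‖taylorCoeff w 3‖ ^ 2
      + ‖taylorCoeff w 4‖ ^ 2 ≤ 1 := by
    simpa [add_assoc] using hbessel
  generalize taylorCoeff w 1 = c₁, taylorCoeff w 2 = c₂, taylorCoeff w 3 = c₃,
    taylorCoeff w 4 = c₄ at hsq ⊢
  refine le_trans ?_ (hankel_majorant_le (norm_nonneg c₁) (norm_nonneg c₂) (norm_nonneg c₃)
    (norm_nonneg c₄) hsq)
  refine (norm_sub_le _ _).trans (add_le_add ((norm_add_le _ _).trans (add_le_add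
    ((norm_add_le _ _).trans (add_le_add ((norm_sub_le _ _).trans (add_le_add
    ((norm_add_le _ _).trans (add_le_add ((norm_sub_le _ _).trans (add_le_add ?_ ?_)) ?_)) ?_))
    ?_)) ?_)) ?_)
  · rw [norm_mul]
    refine mul_le_mul_of_nonneg_right ((norm_sub_le _ _).trans_eq ?_) (norm_nonneg _)
    simp
  all_goals simp

/-! ### The extremal function -/

/-- The integral along segments from `0` of an entire function is a primitive of it. -/
theorem hasDerivAt_segmentIntegral {g : ℂ → ℂ} (hg : Differentiable ℂ g) (z : ℂ) :
    HasDerivAt (segmentIntegral g) (g z) z := by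
  obtain ⟨G, hG⟩ := hg.isExactOn_univ
  have hG' (z : ℂ) : HasDerivAt G (g z) z := hG z (Set.mem_univ z)
  have heq : segmentIntegral g = fun z => G z - G 0 := by
    funext z
    have hderiv (s : ℝ) : HasDerivAt (fun s : ℝ => G ((s : ℂ) * z)) (g ((s : ℂ) * z) * z) s := by
      have h₁ : HasDerivAt (fun s : ℂ => s * z) z (s : ℂ) := by
        simpa using (hasDerivAt_id (s : ℂ)).mul_const z
      exact ((hG' _).comp (s : ℂ) h₁).comp_ofReal
    have hcont : Continuous fun s : ℝ => g ((s : ℂ) * z) * z := by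
      have := hg.continuous
      fun_prop
    rw [segmentIntegral, intervalIntegral.integral_eq_sub_of_hasDerivAt (fun s _ => hderiv s)
      (hcont.intervalIntegrable _ _)]
    simp
  rw [heq]
  exact (hG' z).sub_const _

theorem differentiable_exp_pow_three_sub_one_div :
    Differentiable ℂ fun t : ℂ => (exp (t ^ 3) - 1) / t := by
  have hderiv : HasDerivAt (fun t : ℂ => exp (t ^ 3)) 0 0 := by
    simpa using (hasDerivAt_pow 3 (0 : ℂ)).cexp
  -- The value `0` of the quotient at `0` is the derivative of the exponential there.
  have heq : (fun t : ℂ => (exp (t ^ 3) - 1) / t) = dslope (fun t => exp (t ^ 3)) 0 := by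
    funext t
    rcases eq_or_ne t 0 with rfl | ht
    · simp [hderiv.deriv]
    · simp [dslope_of_ne _ ht, slope_def_field]
  have hd : Differentiable ℂ fun t : ℂ => exp (t ^ 3) := by fun_prop
  rw [heq, ← differentiableOn_univ]
  exact (Complex.differentiableOn_dslope Filter.univ_mem).2 hd.differentiableOn

theorem hasDerivAt_extremalFun (z : ℂ) :
    HasDerivAt extremalFun
      (exp (z ^ 3) * exp (segmentIntegral (fun t => (exp (t ^ 3) - 1) / t) z)) z := by
  have h := (hasDerivAt_id z).mul
    (hasDerivAt_segmentIntegral differentiable_exp_pow_three_sub_one_div z).cexp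
  refine h.congr_deriv ?_
  rcases eq_or_ne z 0 with rfl | hz
  · simp
  · simp only [id]
    field_simp
    ring

theorem isSchwarzFunction_pow_three : IsSchwarzFunction fun z => z ^ 3 := by
  refine ⟨by fun_prop, by simp, fun z hz => ?_⟩
  rw [norm_pow]
  exact pow_le_of_le_one (norm_nonneg z) (mem_ball_zero_iff.1 hz).le three_ne_zero

theorem extremalFun_mem_starlikeExp : extremalFun ∈ starlikeExp := by
  have hquot (z : ℂ) : starlikeQuotient extremalFun z = exp (z ^ 3) := by
    rcases eq_or_ne z 0 with rfl | hz
    · simp [starlikeQuotient]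
    · rw [starlikeQuotient, Function.update_of_ne hz, (hasDerivAt_extremalFun z).deriv,
        extremalFun]
      field_simp [exp_ne_zero]
  have hquot' : starlikeQuotient extremalFun = fun z => exp (z ^ 3) := funext hquot
  refine ⟨⟨fun z _ => (hasDerivAt_extremalFun z).differentiableAt.differentiableWithinAt, ?_, ?_⟩,
    fun z _ hz => mul_ne_zero hz (exp_ne_zero _), ?_, differentiable_exp.differentiableOn,
    fun z => z ^ 3, isSchwarzFunction_pow_three, fun z _ => hquot z⟩
  · simp [extremalFun]
  · rw [(hasDerivAt_extremalFun 0).deriv]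
    simp [segmentIntegral]
  · rw [hquot']
    fun_prop

theorem hankelDet_extremalFun : hankelDet 3 1 extremalFun = -(1 / 9) := by
  obtain ⟨⟨hfd, hf₀, hf₁⟩, -⟩ := extremalFun_mem_starlikeExp
  have h : (fun z => z) * deriv extremalFun =ᶠ[nhds 0] extremalFun * fun z => exp (z ^ 3) := by
    refine Filter.Eventually.of_forall fun z => ?_
    simp only [Pi.mul_apply, (hasDerivAt_extremalFun z).deriv, extremalFun]
    ring
  rw [hankelDet_eq_of_mul_deriv_eq (hfd.analyticAt (ball_mem_nhds 0 one_pos)) hf₀ hf₁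
    (by fun_prop) (by simp) h (taylorCoeff_pow 3 1) (taylorCoeff_pow 3 2) (taylorCoeff_pow 3 3)
    (taylorCoeff_pow 3 4)]
  norm_num

theorem theorem5 :
    (∀ f ∈ starlikeExp,
      hankelDet 3 1 f =
        2 * taylorCoeff f 2 * taylorCoeff f 3 * taylorCoeff f 4 - taylorCoeff f 3 ^ 3
          - taylorCoeff f 4 ^ 2 - taylorCoeff f 2 ^ 2 * taylorCoeff f 5
          + taylorCoeff f 3 * taylorCoeff f 5 ∧
      ‖hankelDet 3 1 f‖ ≤ 1 / 9) ∧
    extremalFun ∈ starlikeExp ∧ ‖hankelDet 3 1 extremalFun‖ = 1 / 9 := by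
  refine ⟨fun f hf => ⟨hankelDet_three_one ?_, norm_hankelDet_three_one_le hf⟩,
    extremalFun_mem_starlikeExp, ?_⟩
  · rw [taylorCoeff_one, hf.1.2.2]
  · rw [hankelDet_extremalFun, norm_neg]
    norm_num
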